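/- **Theorem (robust Williams–Daly–Zachary theorem).** Let $J\ge 0$, $\mathcal J=\{0,1,\dots,J\}$, and let $F$ (the nominal distribution) be a probability distribution on $\mathbb R^{J+1}$ that is absolutely continuous with respect to Lebesgue measure, with density $f$, has full support, and has finite means. Let $\phi:\mathbb R\to[0,+\infty]$ be convex and lower semicontinuous with $\phi(1)=0$ and $1\in\operatorname{int}\operatorname{dom}\phi$, where $\operatorname{dom}\phi=\{\phi<+\infty\}$, and let $\phi^*(s)=\sup_{t\in\mathbb R}\{st-\phi(t)\}$. Assume that $\phi^*$ is strictly convex on its effective domain, and that it is differentiable with $\phi^{*\prime}\ge 0$ in the interior of this domain. For $u,\varepsilon\in\mathbb R^{J+1}$ put $H(u,\varepsilon)=\max_{j\in\mathcal J}\{u_j+\varepsilon_j\}$. For $\rho\ge 0$ let $\mathcal M_\phi(F)$ be the set of probability measures $G\ll F$ with $\mathbb E_F[\phi(dG/dF)]\le\rho$, and define the robust surplus $$W^{DRO}(u)=\sup_{G\in\mathcal M_\phi(F)}\mathbb E_G[H(u,\varepsilon)]\in[-\infty,+\infty].$$ Fix $u\in\mathbb R^{J+1}$ and consider the dual program $$\inf_{\lambda>0,\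 \mu\in\mathbb R}\Psi(\lambda,\mu),\qquad \Psi(\lambda,\mu)=\lambda\rho+\mu+\lambda\,\mathbb E_F\!\left[\phi^*\!\left(\frac{H(u,\varepsilon)-\mu}{\lambda}\right)\right]\in(-\infty,+\infty].$$ Let $(\lambda^\star,\mu^\star)$, $\lambda^\star>0$, be an optimal solution of this program, and assume that $\Psi$ is finite in a neighbourhood of $(\lambda^\star,\mu^\star)$. Then $(\lambda^\star,\mu^\star)$ is the unique optimal solution, and $$g^\star(\varepsilon)=\phi^{*\prime}\!\left(\frac{H(u,\varepsilon)-\mu^\star}{\lambda^\star}\right)f(\varepsilon)$$ is the density of a probability distribution $G^\star\in\mathcal M_\phi(F)$. Moreover: (i) $H(u,\cdot)$ is $G^\star$-integrable and $W^{DRO}(u)=\mathbb E_{G^\star}\big[\max_{j\in\mathcal J}\{u_j+\varepsilon_j\}\big]$. (ii) $W^{DRO}$ is finite in a neighbourhood of $u$ and differentiable at $u$, and $\nabla W^{DRO}(u)=p^\star(u)$, where $p^\star_j(u)=\mathbb P_{G^\star}\big(u_j+\varepsilon_j=\max_{k\in\mathcal J}\{u_k+\varepsilon_k\}\big)$ for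 $j\in\mathcal J$. -/

import Mathlib

open MeasureTheory Set Filter Topology
open scoped ENNReal NNReal

noncomputable section

namespace DRORUM

/-- The space `ℝ^{J+1}` of utility vectors and shock vectors; the alternatives are `0, 1, …, J`. -/
abbrev Vec (J : ℕ) : Type := EuclideanSpace ℝ (Fin (J + 1))

/-- The expectation of an extended real valued function: expectation of the positive part minus
expectation of the negative part. (`⊤ - ⊤ = ⊥` in `EReal`: an undefined expectation never
contributes to a supremum.) -/
def extExpectation {Ω : Type*} [MeasurableSpace Ω] (P : Measure Ω) (X : Ω → EReal) : EReal :=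
  ((∫⁻ ω, (X ω).toENNReal ∂P : ℝ≥0∞) : EReal) - ((∫⁻ ω, (-X ω).toENNReal ∂P : ℝ≥0∞) : EReal)

/-! ### Divergence functions and their conjugates -/

/-- The class `Φ`: closed (lower semicontinuous) convex functions `φ : ℝ → [0, +∞]` that attain
their minimum `0` at the point `1`, which is interior to the effective domain. -/
structure IsDivergenceFunction (φ : ℝ → ℝ≥0∞) : Prop where
  convex : ConvexOn ℝ≥0 Set.univ φ
  closed : LowerSemicontinuous φ
  map_one : φ 1 = 0
  one_mem_interior : (1 : ℝ) ∈ interior {t : ℝ | φ t < ⊤}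

/-- The convex conjugate `φ*(s) = sup_t (s t - φ(t))`. -/
def conj (φ : ℝ → ℝ≥0∞) (s : ℝ) : EReal :=
  ⨆ t : ℝ, ((s * t : ℝ) : EReal) - (φ t : EReal)

/-- The effective domain of `φ*`. -/
def conjDom (φ : ℝ → ℝ≥0∞) : Set ℝ := {s : ℝ | conj φ s < ⊤}

/-- `φ*` as a real function; meaningful on the effective domain `conjDom φ`. -/
def conjReal (φ : ℝ → ℝ≥0∞) (s : ℝ) : ℝ := (conj φ s).toReal

/-- `φ*` is strictly convex on its effective domain, and differentiable with nonnegative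
derivative in the interior of that domain. -/
structure ConjRegular (φ : ℝ → ℝ≥0∞) : Prop where
  strictConvex : StrictConvexOn ℝ (conjDom φ) (conjReal φ)
  differentiable : ∀ s ∈ interior (conjDom φ), DifferentiableAt ℝ (conjReal φ) s
  deriv_nonneg : ∀ s ∈ interior (conjDom φ), 0 ≤ deriv (conjReal φ) s

/-- The `φ`-divergence of `G` with respect to `F`: `E_F[φ(dG/dF)]` if `G ≪ F`, and `+∞`
otherwise. -/
def phiDivergence {Ω : Type*} [MeasurableSpace Ω] (φ : ℝ → ℝ≥0∞) (G F : Measure Ω) : ℝ≥0∞ :=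
  open Classical in
  if G ≪ F then ∫⁻ ω, φ (G.rnDeriv F ω).toReal ∂F else ⊤

/-! ### The random utility model and its robust version -/

variable {J : ℕ}

/-- The conditions on the nominal distribution: an absolutely continuous (with respect to Lebesgue
measure) probability distribution with finite means and with full support. -/
structure IsNominal (F : Measure (Vec J)) : Prop where
  isProbability : IsProbabilityMeasure F
  absolutelyContinuous : F ≪ volume
  finiteMeans : ∀ j, Integrable (fun ε : Vec J => ε j) F
  fullSupport : F.IsOpenPosMeasure

/-- `H(u, ε) = max_j (u_j + ε_j)`. -/
def maxUtility (u ε : Vec J) : ℝ :=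
  Finset.univ.sup' Finset.univ_nonempty (fun j : Fin (J + 1) => u j + ε j)

/-- The uncertainty set `M_φ(F)` of radius `ρ`. -/
def uncertaintySet (φ : ℝ → ℝ≥0∞) (F : Measure (Vec J)) (ρ : ℝ) : Set (Measure (Vec J)) :=
  {G | IsProbabilityMeasure G ∧ G ≪ F ∧ phiDivergence φ G F ≤ ENNReal.ofReal ρ}

/-- The robust surplus function: the supremum of `E_G[H(u, ε)]` over `G` in the uncertainty set. -/
def robustSurplus (φ : ℝ → ℝ≥0∞) (F : Measure (Vec J)) (ρ : ℝ) (u : Vec J) : EReal :=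
  ⨆ G ∈ uncertaintySet φ F ρ, extExpectation G (fun ε => (maxUtility u ε : EReal))

/-- The objective `λ ρ + μ + λ E_F[φ*((H(u, ε) - μ) / λ)]` of the dual program (for `λ > 0`). -/
def dualObjective (φ : ℝ → ℝ≥0∞) (F : Measure (Vec J)) (ρ : ℝ) (u : Vec J) (lam mu : ℝ) : EReal :=
  ((lam * ρ + mu : ℝ) : EReal) +
    (lam : EReal) * extExpectation F (fun ε => conj φ ((maxUtility u ε - mu) / lam))

/-- The set of multipliers `(λ, μ)`, `λ > 0`, at which the dual objective is finite. -/
def dualDomain (φ : ℝ → ℝ≥0∞) (F : Measure (Vec J)) (ρ : ℝ) (u : Vec J) : Set (ℝ × ℝ) :=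
  {q | 0 < q.1 ∧ dualObjective φ F ρ u q.1 q.2 < ⊤}

/-- `(λ, μ)` with `λ > 0` is an optimal solution of the dual program. -/
def IsDualOptimal (φ : ℝ → ℝ≥0∞) (F : Measure (Vec J)) (ρ : ℝ) (u : Vec J) (lam mu : ℝ) : Prop :=
  0 < lam ∧ ∀ lam' mu' : ℝ, 0 < lam' →
    dualObjective φ F ρ u lam mu ≤ dualObjective φ F ρ u lam' mu'

/-- The density `g(ε) = φ*'((H(u, ε) - μ) / λ) f(ε)`, where `f` is the Lebesgue density of `F`. -/
def robustDensity (φ : ℝ → ℝ≥0∞) (F : Measure (Vec J)) (u : Vec J) (lam mu : ℝ) (ε : Vec J) :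
    ℝ≥0∞ :=
  ENNReal.ofReal (deriv (conjReal φ) ((maxUtility u ε - mu) / lam)) * F.rnDeriv volume ε

/-- The distribution with Lebesgue density `robustDensity`. -/
def robustDistribution (φ : ℝ → ℝ≥0∞) (F : Measure (Vec J)) (u : Vec J) (lam mu : ℝ) :
    Measure (Vec J) :=
  volume.withDensity (robustDensity φ F u lam mu)

/-- The vector of choice probabilities `P_G(u_j + ε_j = max_k (u_k + ε_k))`, `j = 0, …, J`. -/
def choiceProb (G : Measure (Vec J)) (u : Vec J) : Vec J :=
  WithLp.toLp 2 (fun j : Fin (J + 1) => G.real {ε : Vec J | u j + ε j = maxUtility u ε})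

end DRORUM

end

noncomputable section

namespace DRORUM

/-! ### The conjugate of a divergence function -/

section Conjugate

variable {φ : ℝ → ℝ≥0∞}

/-! Write ψ = φ*, H = H(u, ·), Z = (H - μ)/λ and d = ψ'(Z) at the optimal multipliers. Finiteness of
the dual forces ψ to be finite on all of ℝ (`conjDom_eq_univ`), so ψ is differentiable and strictly
convex everywhere. The dual minimum is interior to the domain of finiteness, so both partial
derivatives vanish there (`dual_first_order`): the one in μ gives E_F[d] = 1, the one in λ gives
E_F[Z d - ψ(Z)] = ρ. Equality in Fenchel–Young, φ(d) = Z d - ψ(Z), turns the second condition into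
"G* has divergence exactly ρ" (`phiDivergence_withDensity_deriv`). Hence G* is feasible and
E_{G*}[H] = μ + λ E_F[Z d] is the dual value; weak duality (`extExpectation_le_dual`) makes it the
robust surplus.

The gradient is an envelope argument with G* and (λ, μ) frozen: near u, W(v) lies between
E_{G*}[H(v, ·)] and the dual objective at v. The former is above an affine function with slope p*,
by convexity of v ↦ H(v, ε); the latter is differentiable at u with the same slope
(`hasFDerivAt_integral_conj`); both touch W at u (`hasFDerivAt_of_squeeze`).

For uniqueness, the Fenchel–Young gap between two optima is nonnegative with integral zero. Strict
convexity then identifies the two functions Z almost everywhere, hence everywhere since both are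
continuous and F charges open sets. -/

lemma le_conj (φ : ℝ → ℝ≥0∞) (s t : ℝ) : ((s * t : ℝ) : EReal) - (φ t : EReal) ≤ conj φ s :=
  le_iSup (fun t : ℝ => ((s * t : ℝ) : EReal) - (φ t : EReal)) t

lemma self_le_conj (h1 : φ 1 = 0) (s : ℝ) : (s : EReal) ≤ conj φ s := by
  simpa [h1] using le_conj φ s 1

lemma coe_sub_coe_eq {a : ℝ} {x : ℝ≥0∞} (hx : x ≠ ⊤) :
    ((a : ℝ) : EReal) - (x : EReal) = ((a - x.toReal : ℝ) : EReal) := by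
  lift x to ℝ≥0 using hx
  rfl

/-- If `φ*` is infinite at `s`, then it is infinite further out on the ray through `s`. -/
lemma conj_mul_eq_top {s c : ℝ} (hc : 1 ≤ c) (h1 : φ 1 = 0) (hs : conj φ s = ⊤) :
    conj φ (c * s) = ⊤ := by
  by_contra hne
  have hbot : conj φ (c * s) ≠ ⊥ := fun h => by
    have := self_le_conj h1 (c * s)
    exact EReal.coe_ne_bot _ (le_bot_iff.1 (h ▸ this))
  set M := (conj φ (c * s)).toReal with hM
  have hMe : conj φ (c * s) = (M : EReal) := (EReal.coe_toReal hne hbot).symm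
  -- As φ ≥ 0 and c ≥ 1, c (s t - φ(t)) ≤ c s t - φ(t) ≤ M, so s t - φ(t) ≤ M / c ≤ max M 0.
  have : conj φ s ≤ ((max M 0 : ℝ) : EReal) := by
    refine iSup_le fun t => ?_
    by_cases ht : φ t = ⊤
    · simp [ht]
    · have h := le_conj φ (c * s) t
      rw [hMe, coe_sub_coe_eq ht, EReal.coe_le_coe_iff] at h
      rw [coe_sub_coe_eq ht, EReal.coe_le_coe_iff]
      have h0 : 0 ≤ (φ t).toReal := ENNReal.toReal_nonneg
      have hm : M ≤ max M 0 := le_max_left _ _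
      have hm0 : 0 ≤ max M 0 := le_max_right _ _
      nlinarith
  rw [hs] at this
  exact absurd this (by simp)

lemma conj_eq_coe (h1 : φ 1 = 0) (hdom : conjDom φ = Set.univ) (s : ℝ) :
    conj φ s = (conjReal φ s : EReal) := by
  have hs : conj φ s < ⊤ := by
    have : s ∈ conjDom φ := hdom ▸ Set.mem_univ s
    exact this
  refine (EReal.coe_toReal hs.ne fun h => ?_).symm
  have := self_le_conj h1 s
  rw [h] at this
  exact absurd this (by simp)

lemma self_le_conjReal (h1 : φ 1 = 0) (hdom : conjDom φ = Set.univ)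
    (s : ℝ) : s ≤ conjReal φ s := by
  have := self_le_conj h1 s
  rwa [conj_eq_coe h1 hdom, EReal.coe_le_coe_iff] at this

lemma mul_le_add_conjReal (h1 : φ 1 = 0) (hdom : conjDom φ = Set.univ)
    (s : ℝ) {t : ℝ} (ht : φ t ≠ ⊤) :
    s * t ≤ (φ t).toReal + conjReal φ s := by
  have := le_conj φ s t
  rw [conj_eq_coe h1 hdom, coe_sub_coe_eq ht, EReal.coe_le_coe_iff] at this
  linarith

/-- Attainment comes from compactness: finiteness of φ* at s ± 1 makes s t - φ(t) decay linearly in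
|t|, so only a bounded interval competes, and there lower semicontinuity suffices. -/
lemma exists_conjReal_eq (h1 : φ 1 = 0) (hdom : conjDom φ = Set.univ)
    (hlsc : LowerSemicontinuous φ) (s : ℝ) :
    ∃ t, φ t ≠ ⊤ ∧ (φ t).toReal = s * t - conjReal φ s := by
  set ψ := conjReal φ with hψ
  -- For |t| > R, Fenchel–Young at s + 1 or s - 1 gives s t - φ(t) ≤ ψ(s ± 1) - |t| < ψ(s) - 1. The
  -- extra 1 also puts t = 1, where φ is finite, inside the interval.
  set R : ℝ := |ψ (s + 1) - ψ s| + |ψ (s - 1) - ψ s| + 1 with hR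
  have hR1 : 1 ≤ R := by
    have := abs_nonneg (ψ (s + 1) - ψ s)
    have := abs_nonneg (ψ (s - 1) - ψ s)
    linarith
  have hmem1 : (1 : ℝ) ∈ Icc (-R) R := ⟨by linarith, hR1⟩
  -- The constant |s| R makes the linear term nonnegative on [-R, R], so that φ(t) - s t can be
  -- minimised within `ℝ≥0∞`.
  have hlsc' : LowerSemicontinuous
      (fun t : ℝ => φ t + ENNReal.ofReal (|s| * R - s * t)) :=
    hlsc.add (ENNReal.continuous_ofReal.comp
      (by fun_prop : Continuous fun t : ℝ => |s| * R - s * t)).lowerSemicontinuous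
  obtain ⟨t₀, ht₀, hmin⟩ := (hlsc'.lowerSemicontinuousOn (Icc (-R) R)).exists_isMinOn
    ⟨1, hmem1⟩ isCompact_Icc
  have hpos : ∀ t ∈ Icc (-R) R, 0 ≤ |s| * R - s * t := fun t ht => by
    have h : s * t ≤ |s| * |t| := (le_abs_self _).trans (abs_mul s t).le
    have : |s| * |t| ≤ |s| * R := mul_le_mul_of_nonneg_left (abs_le.2 ht) (abs_nonneg s)
    linarith
  have hfin : φ t₀ ≠ ⊤ := fun h => by
    have := hmin hmem1
    simp [h, h1] at this
  have hmin' : ∀ t ∈ Icc (-R) R, φ t ≠ ⊤ →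
      s * t - (φ t).toReal ≤ s * t₀ - (φ t₀).toReal := fun t ht htop => by
    have h := ENNReal.toReal_mono (by simp [htop]) (hmin ht)
    rw [ENNReal.toReal_add hfin ENNReal.ofReal_ne_top, ENNReal.toReal_add htop
      ENNReal.ofReal_ne_top, ENNReal.toReal_ofReal (hpos _ ht₀),
      ENNReal.toReal_ofReal (hpos _ ht)] at h
    linarith
  have hout : ∀ t, t ∉ Icc (-R) R → φ t ≠ ⊤ → s * t - (φ t).toReal ≤ ψ s - 1 :=
      fun t ht htop => by
    have hp := mul_le_add_conjReal h1 hdom (s + 1) htop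
    have hm := mul_le_add_conjReal h1 hdom (s - 1) htop
    have := abs_nonneg (ψ (s + 1) - ψ s)
    have := abs_nonneg (ψ (s - 1) - ψ s)
    have := le_abs_self (ψ (s + 1) - ψ s)
    have := le_abs_self (ψ (s - 1) - ψ s)
    rw [mem_Icc, not_and_or, not_le, not_le] at ht
    rcases ht with ht | ht <;> simp only [← hψ] at hp hm <;> nlinarith
  have hsup : ψ s ≤ max (s * t₀ - (φ t₀).toReal) (ψ s - 1) := by
    rw [← EReal.coe_le_coe_iff, hψ, ← conj_eq_coe h1 hdom, ← hψ]
    refine iSup_le fun t => ?_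
    by_cases htop : φ t = ⊤
    · simp [htop]
    rw [coe_sub_coe_eq htop, EReal.coe_le_coe_iff]
    by_cases ht : t ∈ Icc (-R) R
    · exact le_max_of_le_left (hmin' t ht htop)
    · exact le_max_of_le_right (hout t ht htop)
  have hle : ψ s ≤ s * t₀ - (φ t₀).toReal := by
    rcases le_max_iff.1 hsup with h | h
    · exact h
    · linarith
  have := mul_le_add_conjReal h1 hdom s hfin
  exact ⟨t₀, hfin, by simp only [← hψ] at this; linarith⟩

/-- Equality in the Fenchel–Young inequality at the derivative of the conjugate. -/
lemma apply_deriv_conjReal (h1 : φ 1 = 0) (hdom : conjDom φ = Set.univ)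
    (hlsc : LowerSemicontinuous φ)
    (hdiff : Differentiable ℝ (conjReal φ)) (s : ℝ) :
    φ (deriv (conjReal φ) s) ≠ ⊤ ∧
      (φ (deriv (conjReal φ) s)).toReal = s * deriv (conjReal φ) s - conjReal φ s := by
  obtain ⟨t, htop, ht⟩ := exists_conjReal_eq h1 hdom hlsc s
  have hd : HasDerivAt (fun x => conjReal φ x - x * t) (deriv (conjReal φ) s - 1 * t) s :=
    (hdiff s).hasDerivAt.sub ((hasDerivAt_id s).mul_const t)
  -- By Fenchel–Young, ψ(x) - x t ≥ -φ(t), with equality at x = s; stationarity then identifies the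
  -- maximiser t with ψ'(s).
  have hmin : IsLocalMin (fun x => conjReal φ x - x * t) s := Eventually.of_forall fun x => by
    have := mul_le_add_conjReal h1 hdom x htop
    show conjReal φ s - s * t ≤ conjReal φ x - x * t
    linarith
  have h0 := hmin.hasDerivAt_eq_zero hd
  have : deriv (conjReal φ) s = t := by linarith
  rw [this]
  exact ⟨htop, ht⟩

lemma conjReal_ge_tangent (h1 : φ 1 = 0) (hdom : conjDom φ = Set.univ)
    (hlsc : LowerSemicontinuous φ)
    (hdiff : Differentiable ℝ (conjReal φ)) (s s' : ℝ) :
    conjReal φ s + deriv (conjReal φ) s * (s' - s) ≤ conjReal φ s' := by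
  obtain ⟨htop, ht⟩ := apply_deriv_conjReal h1 hdom hlsc hdiff s
  have := mul_le_add_conjReal h1 hdom s' htop
  linarith

lemma eq_of_conjReal_eq_tangent (h1 : φ 1 = 0) (hdom : conjDom φ = Set.univ)
    (hlsc : LowerSemicontinuous φ)
    (hdiff : Differentiable ℝ (conjReal φ)) (hconv : StrictConvexOn ℝ univ (conjReal φ))
    {s s' : ℝ} (h : conjReal φ s' = conjReal φ s + deriv (conjReal φ) s * (s' - s)) :
    s' = s := by
  by_contra hne
  -- If the tangent at s met the graph again at s', strict convexity would put the midpoint strictly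
  -- below that tangent.
  have h2 := hconv.2 (mem_univ s') (mem_univ s) hne (half_pos one_pos) (half_pos one_pos)
    (add_halves 1)
  have h3 := conjReal_ge_tangent h1 hdom hlsc hdiff s ((1 / 2 : ℝ) • s' + (1 / 2 : ℝ) • s)
  simp only [smul_eq_mul] at h2 h3
  nlinarith

end Conjugate

/-! ### Differentiation of expectations of convex functions -/

/-- A convex function on `[-δ, δ]` is pointwise Lipschitz at `0`. -/
lemma abs_sub_le_of_convexOn {k : ℝ → ℝ} {δ : ℝ} (hδ : 0 < δ) (hk : ConvexOn ℝ (Icc (-δ) δ) k)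
    {t : ℝ} (ht : |t| ≤ δ) :
    |k t - k 0| ≤ (|k δ - k 0| + |k (-δ) - k 0|) / δ * |t| := by
  have h0 : (0 : ℝ) ∈ Icc (-δ) δ := ⟨by linarith, hδ.le⟩
  have hp : δ ∈ Icc (-δ) δ := ⟨by linarith, le_rfl⟩
  have hm : -δ ∈ Icc (-δ) δ := ⟨le_rfl, by linarith⟩
  set a := |t| / δ with ha
  have ha0 : 0 ≤ a := by positivity
  have ha1 : a ≤ 1 := (div_le_one hδ).2 ht
  have had : a * δ = |t| := by rw [ha]; field_simp
  have upper : ∀ e ∈ Icc (-δ) δ, a * e ∈ Icc (-δ) δ ∧ k (a * e) - k 0 ≤ a * (k e - k 0) :=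
      fun e he => by
    have h := hk.2 he h0 ha0 (sub_nonneg.2 ha1) (by ring)
    have h' := hk.1 he h0 ha0 (sub_nonneg.2 ha1) (by ring)
    simp only [smul_eq_mul, mul_zero, add_zero] at h h'
    exact ⟨h', by linarith⟩
  -- Chords to the endpoints bound k from above; a lower bound at x follows by reflecting the upper
  -- bound at -x through 0.
  have hmid : ∀ x ∈ Icc (-δ) δ, -x ∈ Icc (-δ) δ → 2 * k 0 ≤ k x + k (-x) := fun x hx hx' => by
    have h := hk.2 hx hx' (half_pos one_pos).le (half_pos one_pos).le (add_halves 1)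
    have e : (1 / 2 : ℝ) • x + (1 / 2 : ℝ) • (-x) = 0 := by simp
    rw [e] at h
    simp only [smul_eq_mul] at h
    linarith
  have e : (|k δ - k 0| + |k (-δ) - k 0|) / δ * |t| = a * (|k δ - k 0| + |k (-δ) - k 0|) := by
    rw [ha]; ring
  rw [e]
  obtain ⟨mp, up⟩ := upper δ hp
  obtain ⟨mm, um⟩ := upper (-δ) hm
  have l1 := mul_le_mul_of_nonneg_left (le_abs_self (k δ - k 0)) ha0
  have l2 := mul_le_mul_of_nonneg_left (le_abs_self (k (-δ) - k 0)) ha0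
  have l3 := mul_nonneg ha0 (abs_nonneg (k δ - k 0))
  have l4 := mul_nonneg ha0 (abs_nonneg (k (-δ) - k 0))
  rw [mul_neg] at um mm
  rw [had] at up um mp mm
  have hmm := hmid _ mp mm
  rw [mul_add, abs_le]
  rcases abs_choice t with h | h <;> rw [h] at hmm up um
  · constructor <;> linarith
  · rw [neg_neg] at hmm um
    constructor <;> linarith

/-- Convexity supplies the dominating function for the difference quotients from the values at -δ, 0
and δ alone, so no separate bound on the derivative is needed. -/
lemma hasDerivAt_integral_of_convexOn {Ω : Type*} [MeasurableSpace Ω] {P : Measure Ω}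
    {k : ℝ → Ω → ℝ} {k' : Ω → ℝ} {δ : ℝ} (hδ : 0 < δ)
    (hint : ∀ t ∈ Icc (-δ) δ, Integrable (k t) P) (hk' : AEStronglyMeasurable k' P)
    (hconv : ∀ ω, ConvexOn ℝ (Icc (-δ) δ) (fun t => k t ω))
    (hderiv : ∀ ω, HasDerivAt (fun t => k t ω) (k' ω) 0) :
    Integrable k' P ∧ HasDerivAt (fun t => ∫ ω, k t ω ∂P) (∫ ω, k' ω ∂P) 0 := by
  have h0 : (0 : ℝ) ∈ Icc (-δ) δ := ⟨by linarith, hδ.le⟩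
  have hp : δ ∈ Icc (-δ) δ := ⟨by linarith, le_rfl⟩
  have hm : -δ ∈ Icc (-δ) δ := ⟨le_rfl, by linarith⟩
  have hb : Integrable (fun ω => (|k δ ω - k 0 ω| + |k (-δ) ω - k 0 ω|) / δ) P :=
    ((((hint _ hp).sub (hint _ h0)).abs).add (((hint _ hm).sub (hint _ h0)).abs)).div_const δ
  have hmeas : AEStronglyMeasurable
      (fun ω => ContinuousLinearMap.toSpanSingleton ℝ (k' ω)) P :=
    (ContinuousLinearMap.toSpanSingletonCLE (𝕜 := ℝ) (E := ℝ)).continuous.comp_aestronglyMeasurable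
      hk'
  obtain ⟨hi, hd⟩ := hasFDerivAt_integral_of_dominated_loc_of_lip' (𝕜 := ℝ)
    (s := Icc (-δ) δ) (x₀ := (0 : ℝ)) (F := k) (Icc_mem_nhds (by linarith) hδ)
    (fun t ht => (hint t ht).aestronglyMeasurable) (hint 0 h0) hmeas
    (Eventually.of_forall fun ω t ht => by
      simpa using abs_sub_le_of_convexOn hδ (hconv ω) (abs_le.2 ht)) hb
    (Eventually.of_forall fun ω => (hderiv ω).hasFDerivAt)
  have hi' : Integrable k' P := by
    simpa using hi.apply_continuousLinearMap (1 : ℝ)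
  refine ⟨hi', ?_⟩
  have := hd.hasDerivAt
  rwa [ContinuousLinearMap.integral_apply hi, show
    (fun ω => ContinuousLinearMap.toSpanSingleton ℝ (k' ω) (1 : ℝ)) = k' from
      funext fun ω => by simp] at this

/-! ### Extended expectations and weak duality -/

section Expectation

variable {Ω : Type*} [MeasurableSpace Ω] {P : Measure Ω}

lemma integrable_max_zero {X : Ω → ℝ} (hX : AEStronglyMeasurable X P)
    (h : ∫⁻ ω, ENNReal.ofReal (X ω) ∂P ≠ ⊤) : Integrable (fun ω => max (X ω) 0) P := by
  refine ⟨hX.sup aestronglyMeasurable_const, ?_⟩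
  have h0 : 0 ≤ᵐ[P] fun ω => max (X ω) 0 := Eventually.of_forall fun ω => le_max_right _ _
  rw [hasFiniteIntegral_iff_ofReal h0]
  simpa [ENNReal.ofReal_max, lt_top_iff_ne_top] using h

lemma extExpectation_coe_eq (X : Ω → ℝ) :
    extExpectation P (fun ω => (X ω : EReal)) =
      ((∫⁻ ω, ENNReal.ofReal (X ω) ∂P : ℝ≥0∞) : EReal) -
        ((∫⁻ ω, ENNReal.ofReal (-X ω) ∂P : ℝ≥0∞) : EReal) := by
  have (x : ℝ) : (x : EReal).toENNReal = ENNReal.ofReal x := by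
    rw [EReal.toENNReal_of_ne_top (EReal.coe_ne_top x), EReal.toReal_coe]
  simp only [extExpectation, ← EReal.coe_neg, this]

lemma extExpectation_coe {X : Ω → ℝ} (hX : Integrable X P) :
    extExpectation P (fun ω => (X ω : EReal)) = ((∫ ω, X ω ∂P : ℝ) : EReal) := by
  have hp : ∫⁻ ω, ENNReal.ofReal (X ω) ∂P ≠ ⊤ := hX.lintegral_lt_top.ne
  have hm : ∫⁻ ω, ENNReal.ofReal (-X ω) ∂P ≠ ⊤ := hX.neg.lintegral_lt_top.ne
  rw [extExpectation_coe_eq, integral_eq_lintegral_pos_part_sub_lintegral_neg_part hX,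
    EReal.coe_sub, EReal.coe_ennreal_toReal hp, EReal.coe_ennreal_toReal hm]

lemma integrable_of_max_zero {X : Ω → ℝ} (hX : Integrable (fun ω => max (X ω) 0) P)
    (hX' : Integrable (fun ω => max (-X ω) 0) P) : Integrable X P := by
  refine (hX.sub hX').congr (Eventually.of_forall fun ω => ?_)
  simp only [Pi.sub_apply]
  rcases le_total 0 (X ω) with h | h
  · rw [max_eq_left h, max_eq_right (by linarith)]; ring
  · rw [max_eq_right h, max_eq_left (by linarith)]; ring

/-- The integrable minorant controls the negative part; an infinite positive part would then make
the extended expectation `⊤`. -/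
lemma integrable_of_extExpectation_lt_top {X Y : Ω → ℝ} (hX : AEStronglyMeasurable X P)
    (hY : Integrable Y P) (hYX : ∀ ω, Y ω ≤ X ω)
    (h : extExpectation P (fun ω => (X ω : EReal)) < ⊤) : Integrable X P := by
  have hm : ∫⁻ ω, ENNReal.ofReal (-X ω) ∂P ≠ ⊤ := ne_top_of_le_ne_top hY.neg.lintegral_lt_top.ne
    (lintegral_mono fun ω => ENNReal.ofReal_le_ofReal (by simpa using hYX ω))
  have hp : ∫⁻ ω, ENNReal.ofReal (X ω) ∂P ≠ ⊤ := fun htop => by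
    rw [extExpectation_coe_eq, htop, ← EReal.coe_ennreal_toReal hm, EReal.coe_ennreal_top,
      EReal.top_sub_coe] at h
    exact lt_irrefl _ h
  exact integrable_of_max_zero (integrable_max_zero hX hp) (integrable_max_zero hX.neg hm)

variable {φ : ℝ → ℝ≥0∞}

/-- Weak duality between the divergence constrained problem and its dual. -/
lemma extExpectation_le_dual [IsProbabilityMeasure P] (h1 : φ 1 = 0)
    (hdom : conjDom φ = Set.univ) (hlsc : LowerSemicontinuous φ) {ρ : ℝ} (hρ : 0 ≤ ρ)
    {G : Measure Ω} [IsProbabilityMeasure G] (hGP : G ≪ P)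
    (hdiv : phiDivergence φ G P ≤ ENNReal.ofReal ρ) {X : Ω → ℝ} (hX : Measurable X)
    {lam mu : ℝ} (hlam : 0 < lam)
    (hint : Integrable (fun ω => conjReal φ ((X ω - mu) / lam)) P) :
    extExpectation G (fun ω => (X ω : EReal)) ≤
      ((lam * ρ + mu + lam * ∫ ω, conjReal φ ((X ω - mu) / lam) ∂P : ℝ) : EReal) := by
  set r : Ω → ℝ := fun ω => (G.rnDeriv P ω).toReal with hr
  set Z : Ω → ℝ := fun ω => (X ω - mu) / lam with hZ
  have hXZ (ω : Ω) : X ω = mu + lam * Z ω := by simp only [hZ]; field_simp; ring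
  have hr0 (ω : Ω) : 0 ≤ r ω := ENNReal.toReal_nonneg
  have hrm : Measurable r := (Measure.measurable_rnDeriv G P).ennreal_toReal
  have hrint : Integrable r P := Measure.integrable_toReal_rnDeriv
  have hr1 : ∫ ω, r ω ∂P = 1 := by simp [hr, Measure.integral_toReal_rnDeriv hGP]
  have hφm : Measurable (fun ω => φ (r ω)) := hlsc.measurable.comp hrm
  rw [phiDivergence, if_pos hGP] at hdiv
  have hne : ∫⁻ ω, φ (r ω) ∂P ≠ ⊤ := ne_top_of_le_ne_top ENNReal.ofReal_ne_top hdiv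
  have hφint : Integrable (fun ω => (φ (r ω)).toReal) P :=
    integrable_toReal_of_lintegral_ne_top hφm.aemeasurable hne
  have hφtop : ∀ᵐ ω ∂P, φ (r ω) < ⊤ := ae_lt_top hφm hne
  have hφle : ∫ ω, (φ (r ω)).toReal ∂P ≤ ρ := by
    rw [integral_toReal hφm.aemeasurable hφtop]
    exact ENNReal.toReal_le_of_le_ofReal hρ hdiv
  have hyoung : ∀ᵐ ω ∂P, Z ω * r ω ≤ (φ (r ω)).toReal + conjReal φ (Z ω) := by
    filter_upwards [hφtop] with ω hω using mul_le_add_conjReal h1 hdom _ hω.ne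
  -- With an infinite negative part the extended expectation is `⊥`, whatever the positive part.
  by_cases hneg : ∫⁻ ω, ENNReal.ofReal (-X ω) ∂G = ⊤
  · rw [extExpectation_coe_eq, hneg, EReal.coe_ennreal_top, EReal.sub_top]
    exact bot_le
  -- Fenchel–Young for Z r, with r = dG/dP, dominates the positive part of X r by P-integrable
  -- terms.
  have hposint : Integrable (fun ω => max (X ω) 0) G := by
    rw [← integrable_rnDeriv_smul_iff hGP]
    refine (((hrint.const_mul |mu|).add ((hφint.add hint.abs).const_mul lam))).mono'
      ((hrm.mul (hX.max measurable_const)).aestronglyMeasurable) ?_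
    filter_upwards [hyoung] with ω hω
    have hφ0 : 0 ≤ (φ (r ω)).toReal := ENNReal.toReal_nonneg
    have hψ := le_abs_self (conjReal φ (Z ω))
    have hψ0 := abs_nonneg (conjReal φ (Z ω))
    have hZp : max (Z ω) 0 * r ω ≤ (φ (r ω)).toReal + |conjReal φ (Z ω)| := by
      rcases le_total 0 (Z ω) with h | h
      · rw [max_eq_left h]; linarith
      · rw [max_eq_right h]; linarith
    have hXp : max (X ω) 0 ≤ |mu| + lam * max (Z ω) 0 := by
      have h1 := le_abs_self mu
      have h2 := mul_le_mul_of_nonneg_left (le_max_left (Z ω) 0) hlam.le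
      have h3 : 0 ≤ lam * max (Z ω) 0 := mul_nonneg hlam.le (le_max_right _ _)
      exact max_le (by rw [hXZ]; linarith) (by positivity)
    have hX0 : 0 ≤ max (X ω) 0 := le_max_right _ _
    have e1 := mul_le_mul_of_nonneg_left hXp (hr0 ω)
    have e2 := mul_le_mul_of_nonneg_left hZp hlam.le
    simp only [smul_eq_mul, Pi.add_apply]
    rw [Real.norm_of_nonneg (mul_nonneg (hr0 ω) hX0)]
    simp only [hZ] at e1 e2 ⊢
    nlinarith
  have hXG : Integrable X G := integrable_of_max_zero hposint
    (integrable_max_zero hX.neg.aestronglyMeasurable hneg)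
  rw [extExpectation_coe hXG, EReal.coe_le_coe_iff, ← integral_rnDeriv_smul hGP]
  have hXP : Integrable (fun ω => r ω * X ω) P := (integrable_rnDeriv_smul_iff hGP).2 hXG
  calc ∫ ω, r ω * X ω ∂P
      ≤ ∫ ω, (mu * r ω + lam * ((φ (r ω)).toReal + conjReal φ (Z ω))) ∂P := by
        refine integral_mono_ae hXP
          ((hrint.const_mul mu).add ((hφint.add hint).const_mul lam)) ?_
        filter_upwards [hyoung] with ω hω
        have := mul_le_mul_of_nonneg_left hω hlam.le
        simp only [hXZ ω]
        linarith
    _ = mu + lam * (∫ ω, (φ (r ω)).toReal ∂P + ∫ ω, conjReal φ (Z ω) ∂P) := by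
        have h := integral_add (hrint.const_mul mu) ((hφint.add hint).const_mul lam)
        simp only [Pi.add_apply] at h
        rw [h, integral_const_mul, integral_const_mul, integral_add hφint hint, hr1, mul_one]
    _ ≤ lam * ρ + mu + lam * ∫ ω, conjReal φ (Z ω) ∂P := by
        have := mul_le_mul_of_nonneg_left hφle hlam.le
        linarith

end Expectation

/-! ### First order conditions -/

section FirstOrder

/-- Jensen's inequality for ψ at x/a and x/b with weights s a/(s a + t b) and t b/(s a + t b), whose
barycentre is x/(s a + t b). -/
lemma convexOn_perspective {ψ : ℝ → ℝ} (hψ : ConvexOn ℝ univ ψ) (x : ℝ) :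
    ConvexOn ℝ (Ioi 0) (fun l => l * ψ (x / l)) := by
  refine ⟨convex_Ioi 0, fun a ha b hb s t hs ht hst => ?_⟩
  have ha' : 0 < a := ha
  have hb' : 0 < b := hb
  have hc : 0 < s * a + t * b := (convex_Ioi (0 : ℝ)) ha hb hs ht hst
  have h := hψ.2 (mem_univ (x / a)) (mem_univ (x / b))
    (show 0 ≤ s * a / (s * a + t * b) by positivity)
    (show 0 ≤ t * b / (s * a + t * b) by positivity) (by field_simp)
  have e : s * a / (s * a + t * b) * (x / a) + t * b / (s * a + t * b) * (x / b) =
      x / (s * a + t * b) := by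
    field_simp
    rw [hst, mul_one]
  simp only [smul_eq_mul] at h ⊢
  rw [e] at h
  calc (s * a + t * b) * ψ (x / (s * a + t * b))
      ≤ (s * a + t * b) * (s * a / (s * a + t * b) * ψ (x / a) +
          t * b / (s * a + t * b) * ψ (x / b)) := mul_le_mul_of_nonneg_left h hc.le
    _ = s * (a * ψ (x / a)) + t * (b * ψ (x / b)) := by field_simp

variable {Ω : Type*} [MeasurableSpace Ω] {P : Measure Ω}

/-- The first order conditions for a minimum of
`(λ, μ) ↦ λ ρ + μ + λ E[ψ((X - μ) / λ)]`. -/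
lemma dual_first_order {ψ : ℝ → ℝ} (hconv : ConvexOn ℝ univ ψ)
    (hdiff : Differentiable ℝ ψ) {X : Ω → ℝ} (hX : Measurable X) {lam mu ρ δ : ℝ}
    (hδ : 0 < δ) (hδlam : δ < lam)
    (hint : ∀ l m : ℝ, |l - lam| ≤ δ → |m - mu| ≤ δ →
      Integrable (fun ω => ψ ((X ω - m) / l)) P)
    (hopt : ∀ l m : ℝ, |l - lam| ≤ δ → |m - mu| ≤ δ →
      lam * ρ + mu + lam * ∫ ω, ψ ((X ω - mu) / lam) ∂P ≤
        l * ρ + m + l * ∫ ω, ψ ((X ω - m) / l) ∂P) :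
    (Integrable (fun ω => deriv ψ ((X ω - mu) / lam)) P ∧
      ∫ ω, deriv ψ ((X ω - mu) / lam) ∂P = 1) ∧
    (Integrable (fun ω => (X ω - mu) / lam * deriv ψ ((X ω - mu) / lam)) P ∧
      ∫ ω, (X ω - mu) / lam * deriv ψ ((X ω - mu) / lam) ∂P =
        ρ + ∫ ω, ψ ((X ω - mu) / lam) ∂P) := by
  have hlam : 0 < lam := hδ.trans hδlam
  have hZ : Measurable (fun ω => (X ω - mu) / lam) := (hX.sub_const mu).div_const lam
  have hd : Measurable (fun ω => deriv ψ ((X ω - mu) / lam)) := (measurable_deriv ψ).comp hZ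
  have h0 : |(0 : ℝ)| ≤ δ := by simpa using hδ.le
  have hnear : ∀ᶠ t in 𝓝 (0 : ℝ), |t| ≤ δ := by
    filter_upwards [Icc_mem_nhds (neg_lt_zero.2 hδ) hδ] with t ht using abs_le.2 ht
  have hi0 := hint lam mu (by simpa using hδ.le) (by simpa using hδ.le)
  constructor
  -- Stationarity in μ: the derivative of the objective is 1 - E[ψ'(Z)].
  · obtain ⟨hi, hD⟩ := hasDerivAt_integral_of_convexOn (P := P) hδ
      (k := fun t ω => ψ ((X ω - (mu + t)) / lam))
      (k' := fun ω => deriv ψ ((X ω - mu) / lam) * (-1 / lam))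
      (fun t ht => hint lam (mu + t) (by simpa using hδ.le) (by simpa using abs_le.2 ht))
      (hd.mul_const _).aestronglyMeasurable
      (fun ω => by
        refine ⟨convex_Icc _ _, fun a _ b _ s t hs ht hst => ?_⟩
        have h := hconv.2 (mem_univ ((X ω - (mu + a)) / lam)) (mem_univ ((X ω - (mu + b)) / lam))
          hs ht hst
        convert h using 2
        simp only [smul_eq_mul]
        field_simp
        linear_combination (mu - X ω) * hst)
      (fun ω => by
        have h2 : HasDerivAt (fun t : ℝ => (X ω - (mu + t)) / lam) (-1 / lam) 0 := by
          simpa using (((hasDerivAt_id (0 : ℝ)).const_add mu).const_sub (X ω)).div_const lam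
        have h3 : HasDerivAt ψ (deriv ψ ((X ω - mu) / lam)) ((X ω - (mu + 0)) / lam) := by
          rw [add_zero]; exact (hdiff _).hasDerivAt
        exact h3.comp (0 : ℝ) h2)
    have hi' : Integrable (fun ω => deriv ψ ((X ω - mu) / lam)) P := by
      refine (hi.mul_const (-lam)).congr (Eventually.of_forall fun ω => ?_)
      simp only
      field_simp
    refine ⟨hi', ?_⟩
    rw [integral_mul_const] at hD
    have hK := ((hasDerivAt_id (0 : ℝ)).const_add (lam * ρ + mu)).add (hD.const_mul lam)
    have hmin : IsLocalMin ((fun t : ℝ => lam * ρ + mu + id t) +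
        fun t => lam * ∫ ω, ψ ((X ω - (mu + t)) / lam) ∂P) 0 := by
      filter_upwards [hnear] with t ht
      have := hopt lam (mu + t) (by simpa using hδ.le) (by simpa using ht)
      simp only [Pi.add_apply, id, add_zero]
      linarith
    have := hmin.hasDerivAt_eq_zero hK
    field_simp at this
    linarith
  -- Stationarity in λ: the derivative of λ ψ(x/λ) is ψ(x/λ) - (x/λ) ψ'(x/λ), and convexity in λ is
  -- that of the perspective.
  · have hpos : ∀ t ∈ Icc (-δ) δ, 0 < lam + t := fun t ht => by linarith [ht.1]
    obtain ⟨hi, hD⟩ := hasDerivAt_integral_of_convexOn (P := P) hδ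
      (k := fun t ω => (lam + t) * ψ ((X ω - mu) / (lam + t)))
      (k' := fun ω => ψ ((X ω - mu) / lam) -
        (X ω - mu) / lam * deriv ψ ((X ω - mu) / lam))
      (fun t ht => (hint (lam + t) mu (by simpa using abs_le.2 ht)
        (by simpa using hδ.le)).const_mul _)
      (hi0.aestronglyMeasurable.sub (hZ.mul hd).aestronglyMeasurable)
      (fun ω => by
        refine ⟨convex_Icc _ _, fun a ha b hb s t hs ht hst => ?_⟩
        have h := (convexOn_perspective hconv (X ω - mu)).2 (hpos a ha) (hpos b hb) hs ht hst
        have e : s • (lam + a) + t • (lam + b) = lam + (s • a + t • b) := by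
          simp only [smul_eq_mul]
          linear_combination lam * hst
        rwa [e] at h)
      (fun ω => by
        have h1 : HasDerivAt (fun t : ℝ => lam + t) 1 0 := (hasDerivAt_id (0 : ℝ)).const_add lam
        have h2 := (h1.fun_inv (by simpa using hlam.ne')).const_mul (X ω - mu)
        have h3 : HasDerivAt ψ (deriv ψ ((X ω - mu) / lam)) ((X ω - mu) * (lam + 0)⁻¹) := by
          rw [add_zero, ← div_eq_mul_inv]; exact (hdiff _).hasDerivAt
        have h4 := h1.mul (h3.comp (0 : ℝ) h2)
        have e : ((fun t : ℝ => lam + t) * (ψ ∘ fun t => (X ω - mu) * (lam + t)⁻¹)) =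
            fun t => (lam + t) * ψ ((X ω - mu) / (lam + t)) := by
          funext t; simp [div_eq_mul_inv]
        rw [e] at h4
        refine h4.congr_deriv ?_
        simp only [add_zero, ← div_eq_mul_inv, Function.comp_apply]
        field_simp
        ring)
    have hi' : Integrable (fun ω => (X ω - mu) / lam * deriv ψ ((X ω - mu) / lam)) P := by
      refine (hi0.sub hi).congr (Eventually.of_forall fun ω => ?_)
      simp
    refine ⟨hi', ?_⟩
    rw [integral_sub hi0 hi'] at hD
    simp only [integral_const_mul] at hD
    have hK := (((hasDerivAt_id (0 : ℝ)).const_add lam).mul_const ρ).add hD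
    have hmin : IsLocalMin ((fun t : ℝ => (lam + id t) * ρ) +
        fun t => (lam + t) * ∫ ω, ψ ((X ω - mu) / (lam + t)) ∂P) 0 := by
      filter_upwards [hnear] with t ht
      have := hopt (lam + t) mu (by simpa using ht) (by simpa using hδ.le)
      simp only [Pi.add_apply, id, add_zero]
      linarith
    have := hmin.hasDerivAt_eq_zero hK
    linarith

end FirstOrder

variable {J : ℕ}

/-! ### The maximal utility -/

section MaxUtility

lemma le_maxUtility (u ε : Vec J) (j : Fin (J + 1)) : u j + ε j ≤ maxUtility u ε :=
  Finset.le_sup' (fun j : Fin (J + 1) => u j + ε j) (Finset.mem_univ j)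

lemma exists_eq_maxUtility (u ε : Vec J) : ∃ j, u j + ε j = maxUtility u ε := by
  obtain ⟨j, -, hj⟩ := Finset.exists_mem_eq_sup' Finset.univ_nonempty
    (fun j : Fin (J + 1) => u j + ε j)
  exact ⟨j, hj.symm⟩

lemma continuous_maxUtility (u : Vec J) : Continuous (maxUtility u) := by
  unfold maxUtility
  exact Continuous.finset_sup'_apply _ fun j _ => by fun_prop

lemma maxUtility_le_add_norm (u v ε : Vec J) : maxUtility v ε ≤ maxUtility u ε + ‖v - u‖ := by
  obtain ⟨j, hj⟩ := exists_eq_maxUtility v ε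
  have h1 := le_maxUtility u ε j
  have h2 : |v j - u j| ≤ ‖v - u‖ := by simpa using PiLp.norm_apply_le (v - u) j
  have h3 := le_abs_self (v j - u j)
  linarith

lemma abs_maxUtility_sub_le (u v ε : Vec J) : |maxUtility v ε - maxUtility u ε| ≤ ‖v - u‖ := by
  have h1 := maxUtility_le_add_norm u v ε
  have h2 := maxUtility_le_add_norm v u ε
  rw [norm_sub_rev] at h2
  rw [abs_le]
  constructor <;> linarith

lemma exists_maxUtility_eq (u : Vec J) (c : ℝ) : ∃ ε, maxUtility u ε = c := by
  refine ⟨WithLp.toLp 2 fun j => c - u j, ?_⟩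
  obtain ⟨j, hj⟩ := exists_eq_maxUtility u (WithLp.toLp 2 fun j => c - u j)
  rw [← hj]
  simp

lemma IsNominal.integrable_maxUtility {F : Measure (Vec J)} (hF : IsNominal F) (u : Vec J) :
    Integrable (maxUtility u) F := by
  have := hF.isProbability
  have hb : Integrable (fun ε : Vec J => ∑ j, |u j + ε j|) F :=
    integrable_finsetSum _ fun j _ => ((integrable_const (u j)).add (hF.finiteMeans j)).abs
  refine hb.mono' (continuous_maxUtility u).aestronglyMeasurable
    (Eventually.of_forall fun ε => ?_)
  obtain ⟨j, hj⟩ := exists_eq_maxUtility u ε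
  rw [← hj, Real.norm_eq_abs]
  exact Finset.single_le_sum (f := fun j => |u j + ε j|) (fun i _ => abs_nonneg _)
    (Finset.mem_univ j)

/-- Ties between alternatives form a null set. -/
lemma ae_forall_ne {F : Measure (Vec J)} (hF : F ≪ volume) (u : Vec J) :
    ∀ᵐ ε ∂F, ∀ i j : Fin (J + 1), i ≠ j → u i + ε i ≠ u j + ε j := by
  suffices h : ∀ᵐ ε ∂(volume : Measure (Vec J)), ∀ i j : Fin (J + 1), i ≠ j →
      u i + ε i ≠ u j + ε j from hF.ae_le h
  rw [ae_all_iff]; intro i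
  rw [ae_all_iff]; intro j
  by_cases hij : i = j
  · simp [hij]
  -- A tie between i and j means that ε + u lies in the proper subspace x_i = x_j, which is Lebesgue
  -- null.
  set S : Submodule ℝ (Vec J) := LinearMap.ker
    ((EuclideanSpace.proj i - EuclideanSpace.proj j : Vec J →L[ℝ] ℝ) : Vec J →ₗ[ℝ] ℝ) with hS
  have hmem (x : Vec J) : x ∈ S ↔ x i - x j = 0 := by
    simp [hS, LinearMap.mem_ker]
  have hne : S ≠ ⊤ := fun h => by
    have : EuclideanSpace.single i (1 : ℝ) ∈ S := h ▸ Submodule.mem_top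
    rw [hmem] at this
    simp [Ne.symm hij] at this
  have h0 : volume ((fun ε : Vec J => ε + u) ⁻¹' (S : Set (Vec J))) = 0 := by
    rw [measure_preimage_add_right]
    exact Measure.addHaar_submodule volume S hne
  refine measure_mono_null (fun ε hε => ?_) h0
  have hε' : u i + ε i = u j + ε j := by
    by_contra h
    exact hε fun _ => h
  show ε + u ∈ S
  rw [hmem]
  simp only [PiLp.add_apply]
  linarith

/-- The set of shocks at which alternative `j` is optimal. -/
def choiceRegion (u : Vec J) (j : Fin (J + 1)) : Set (Vec J) :=
  {ε : Vec J | u j + ε j = maxUtility u ε}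

lemma measurableSet_choiceRegion (u : Vec J) (j : Fin (J + 1)) :
    MeasurableSet (choiceRegion u j) :=
  (isClosed_eq (by fun_prop) (continuous_maxUtility u)).measurableSet

/-- The derivative of `u ↦ H(u, ε)`, for `ε` without ties. -/
def maxUtilityFDeriv (u ε : Vec J) : Vec J →L[ℝ] ℝ :=
  ∑ j, (choiceRegion u j).indicator
    (fun _ => (EuclideanSpace.proj j : Vec J →L[ℝ] ℝ)) ε

lemma stronglyMeasurable_maxUtilityFDeriv (u : Vec J) :
    StronglyMeasurable (maxUtilityFDeriv u) := by
  unfold maxUtilityFDeriv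
  exact Finset.stronglyMeasurable_fun_sum _ fun j _ =>
    stronglyMeasurable_const.indicator (measurableSet_choiceRegion u j)

lemma maxUtilityFDeriv_apply (u ε w : Vec J) :
    maxUtilityFDeriv u ε w = ∑ j, (choiceRegion u j).indicator (fun _ => w j) ε := by
  simp only [maxUtilityFDeriv, sum_apply]
  refine Finset.sum_congr rfl fun j _ => ?_
  by_cases h : ε ∈ choiceRegion u j <;> simp [h]

lemma exists_maxUtilityFDeriv_eq {u ε : Vec J}
    (h : ∀ i j : Fin (J + 1), i ≠ j → u i + ε i ≠ u j + ε j) :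
    ∃ k, maxUtilityFDeriv u ε = EuclideanSpace.proj k ∧ u k + ε k = maxUtility u ε ∧
      ∀ j, j ≠ k → u j + ε j < u k + ε k := by
  obtain ⟨k, hk⟩ := exists_eq_maxUtility u ε
  refine ⟨k, ?_, hk, fun j hj => lt_of_le_of_ne (hk ▸ le_maxUtility u ε j) (h j k hj)⟩
  unfold maxUtilityFDeriv
  rw [Finset.sum_eq_single k]
  · exact Set.indicator_of_mem (show ε ∈ choiceRegion u k from hk) _
  · intro j _ hj
    refine Set.indicator_of_notMem (fun hmem => h j k hj ?_) _
    exact Eq.trans hmem hk.symm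
  · simp

/-- Without ties the maximiser k is strict and stays so near u, so H(v, ε) is locally v_k + ε_k. -/
lemma hasFDerivAt_maxUtility {u ε : Vec J}
    (h : ∀ i j : Fin (J + 1), i ≠ j → u i + ε i ≠ u j + ε j) :
    HasFDerivAt (fun v => maxUtility v ε) (maxUtilityFDeriv u ε) u := by
  obtain ⟨k, hk, -, hlt⟩ := exists_maxUtilityFDeriv_eq h
  rw [hk]
  have h1 : HasFDerivAt (fun v : Vec J => v k + ε k) (EuclideanSpace.proj k : Vec J →L[ℝ] ℝ) u :=
    ((EuclideanSpace.proj k : Vec J →L[ℝ] ℝ).hasFDerivAt).add_const (ε k)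
  refine h1.congr_of_eventuallyEq ?_
  have hev : ∀ᶠ v in 𝓝 u, ∀ j, j ≠ k → v j + ε j < v k + ε k := by
    rw [eventually_all]
    intro j
    by_cases hj : j = k
    · simp [hj]
    · have hc : Continuous fun v : Vec J => v j + ε j := by fun_prop
      have hc' : Continuous fun v : Vec J => v k + ε k := by fun_prop
      filter_upwards [hc.continuousAt.eventually_lt hc'.continuousAt (hlt j hj)] with v hv _
        using hv
  filter_upwards [hev] with v hv
  obtain ⟨j, hj⟩ := exists_eq_maxUtility v ε
  by_cases hjk : j = k
  · rw [← hj, hjk]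
  · have := hv j hjk
    have := le_maxUtility v ε k
    linarith

lemma maxUtility_add_fderiv_le {u ε : Vec J}
    (h : ∀ i j : Fin (J + 1), i ≠ j → u i + ε i ≠ u j + ε j) (v : Vec J) :
    maxUtility u ε + maxUtilityFDeriv u ε (v - u) ≤ maxUtility v ε := by
  obtain ⟨k, hk, hmax, -⟩ := exists_maxUtilityFDeriv_eq h
  have := le_maxUtility v ε k
  have e : maxUtilityFDeriv u ε (v - u) = v k - u k := by simp [hk]
  linarith

lemma integrable_maxUtilityFDeriv_apply (G : Measure (Vec J)) [IsProbabilityMeasure G]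
    (u w : Vec J) : Integrable (fun ε => maxUtilityFDeriv u ε w) G := by
  simp only [maxUtilityFDeriv_apply]
  exact integrable_finsetSum _ fun j _ =>
    (integrable_const _).indicator (measurableSet_choiceRegion u j)

lemma integral_maxUtilityFDeriv_apply (G : Measure (Vec J)) [IsProbabilityMeasure G]
    (u w : Vec J) : ∫ ε, maxUtilityFDeriv u ε w ∂G = inner ℝ (choiceProb G u) w := by
  simp only [maxUtilityFDeriv_apply]
  rw [integral_finsetSum _ fun j _ =>
    (integrable_const _).indicator (measurableSet_choiceRegion u j)]
  rw [PiLp.inner_apply]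
  refine Finset.sum_congr rfl fun j _ => ?_
  rw [integral_indicator_const _ (measurableSet_choiceRegion u j)]
  simp [choiceProb, choiceRegion, mul_comm]

end MaxUtility

/-! ### The dual program -/

section Dual

variable {F : Measure (Vec J)} {φ : ℝ → ℝ≥0∞}

lemma extExpectation_conj_lt_top {ρ : ℝ} {u : Vec J} {l m : ℝ} (hl : 0 < l)
    (h : dualObjective φ F ρ u l m < ⊤) :
    extExpectation F (fun ε => conj φ ((maxUtility u ε - m) / l)) < ⊤ := by
  rw [lt_top_iff_ne_top]
  intro htop
  rw [dualObjective, htop, EReal.coe_mul_top_of_pos hl, EReal.coe_add_top] at h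
  exact lt_irrefl _ h

/-- Since the maximal utility has full support, a finite dual objective forces `φ*` to be finite
everywhere. -/
lemma conjDom_eq_univ (hF : IsNominal F) (h1 : φ 1 = 0) {u : Vec J} {l m : ℝ} (hl : 0 < l)
    (h : extExpectation F (fun ε => conj φ ((maxUtility u ε - m) / l)) < ⊤) :
    conjDom φ = Set.univ := by
  have := hF.isProbability
  have := hF.fullSupport
  set Z : Vec J → ℝ := fun ε => (maxUtility u ε - m) / l with hZ
  have hZc : Continuous Z := ((continuous_maxUtility u).sub continuous_const).div_const l
  have hZs (c : ℝ) : ∃ ε, Z ε = c := by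
    obtain ⟨ε, hε⟩ := exists_maxUtility_eq u (l * c + m)
    exact ⟨ε, by simp only [hZ, hε]; field_simp; ring⟩
  -- A nonempty open set has positive F-mass, so φ*(Z) = ∞ on it makes the positive part infinite.
  -- The negative part stays finite because φ*(s) ≥ s and H has finite mean.
  have key : ∀ A : Set (Vec J), IsOpen A → A.Nonempty →
      (∀ ε ∈ A, conj φ (Z ε) = ⊤) → False := by
    intro A hA hAne htop
    have hpos : F A ≠ 0 := (hA.measure_pos F hAne).ne'
    have hp : ∫⁻ ε, (conj φ (Z ε)).toENNReal ∂F = ⊤ := by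
      rw [eq_top_iff]
      calc (⊤ : ℝ≥0∞) = ∫⁻ _ in A, ⊤ ∂F := by
            rw [setLIntegral_const, ENNReal.top_mul hpos]
        _ = ∫⁻ ε in A, (conj φ (Z ε)).toENNReal ∂F :=
            setLIntegral_congr_fun hA.measurableSet fun ε hε => by simp [htop ε hε]
        _ ≤ _ := setLIntegral_le_lintegral _ _
    have hZi : Integrable Z F :=
      ((hF.integrable_maxUtility u).sub (integrable_const m)).div_const l
    have hm : ∫⁻ ε, (-conj φ (Z ε)).toENNReal ∂F ≠ ⊤ := by
      refine ne_top_of_le_ne_top hZi.neg.lintegral_lt_top.ne (lintegral_mono fun ε => ?_)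
      have hle : -conj φ (Z ε) ≤ ((-Z ε : ℝ) : EReal) := by
        rw [EReal.coe_neg]
        exact EReal.neg_le_neg_iff.2 (self_le_conj h1 (Z ε))
      refine (EReal.toENNReal_le_toENNReal hle).trans_eq ?_
      rw [EReal.toENNReal_of_ne_top (EReal.coe_ne_top _), EReal.toReal_coe]
      rfl
    rw [extExpectation, hp, ← EReal.coe_ennreal_toReal hm, EReal.coe_ennreal_top,
      EReal.top_sub_coe] at h
    exact lt_irrefl _ h
  by_contra hne
  obtain ⟨s, hs⟩ := (Set.ne_univ_iff_exists_notMem _).1 hne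
  have hs' : conj φ s = ⊤ := by simpa [conjDom] using hs
  rcases lt_trichotomy s 0 with hneg | rfl | hpos
  -- φ* is infinite on the whole ray beyond s, whose preimage under Z is open, and nonempty since Z
  -- is onto ℝ.
  · obtain ⟨ε, hε⟩ := hZs (s - 1)
    refine key (Z ⁻¹' Iio s) (isOpen_Iio.preimage hZc) ⟨ε, by simp [hε]⟩ fun x hx => ?_
    have hc : 1 ≤ Z x / s := (one_le_div_of_neg hneg).2 (le_of_lt hx)
    have := conj_mul_eq_top hc h1 hs'
    rwa [div_mul_cancel₀ _ hneg.ne] at this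
  · have : conj φ 0 ≤ 0 := iSup_le fun t => by
      simpa using EReal.coe_ennreal_nonneg (φ t)
    rw [hs'] at this
    exact absurd this (by simp)
  · obtain ⟨ε, hε⟩ := hZs (s + 1)
    refine key (Z ⁻¹' Ioi s) (isOpen_Ioi.preimage hZc) ⟨ε, by simp [hε]⟩ fun x hx => ?_
    have hc : 1 ≤ Z x / s := (one_le_div hpos).2 (le_of_lt hx)
    have := conj_mul_eq_top hc h1 hs'
    rwa [div_mul_cancel₀ _ hpos.ne'] at this

lemma integrable_conjReal_of_lt_top (hF : IsNominal F) (h1 : φ 1 = 0)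
    (hdom : conjDom φ = Set.univ) (hcont : Continuous (conjReal φ)) {u : Vec J} {ρ l m : ℝ}
    (hl : 0 < l) (h : dualObjective φ F ρ u l m < ⊤) :
    Integrable (fun ε => conjReal φ ((maxUtility u ε - m) / l)) F := by
  have := hF.isProbability
  have h' := extExpectation_conj_lt_top hl h
  simp only [conj_eq_coe h1 hdom] at h'
  have hZc : Continuous fun ε => (maxUtility u ε - m) / l :=
    ((continuous_maxUtility u).sub continuous_const).div_const l
  exact integrable_of_extExpectation_lt_top (hcont.comp hZc).aestronglyMeasurable
    (((hF.integrable_maxUtility u).sub (integrable_const m)).div_const l)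
    (fun ε => self_le_conjReal h1 hdom _) h'

lemma dualObjective_eq_coe (h1 : φ 1 = 0) (hdom : conjDom φ = Set.univ) {u : Vec J} {ρ l m : ℝ}
    (h : Integrable (fun ε => conjReal φ ((maxUtility u ε - m) / l)) F) :
    dualObjective φ F ρ u l m =
      ((l * ρ + m + l * ∫ ε, conjReal φ ((maxUtility u ε - m) / l) ∂F : ℝ) : EReal) := by
  simp only [dualObjective, conj_eq_coe h1 hdom]
  rw [extExpectation_coe h]
  norm_cast

lemma robustDistribution_eq [SigmaFinite F] (hF : F ≪ volume) (u : Vec J) (lam mu : ℝ) :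
    robustDistribution φ F u lam mu = F.withDensity
      (fun ε => ENNReal.ofReal (deriv (conjReal φ) ((maxUtility u ε - mu) / lam))) := by
  have hm : Measurable
      (fun ε => ENNReal.ofReal (deriv (conjReal φ) ((maxUtility u ε - mu) / lam))) :=
    ((measurable_deriv _).comp
      (((continuous_maxUtility u).measurable.sub_const mu).div_const lam)).ennreal_ofReal
  conv_rhs => rw [← Measure.withDensity_rnDeriv_eq F volume hF]
  rw [← withDensity_mul _ (Measure.measurable_rnDeriv F volume) hm, mul_comm]
  rfl

end Dual

/-- A function squeezed between an affine function and a differentiable function that touch it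
at a point is differentiable there. -/
lemma hasFDerivAt_of_squeeze {E : Type*} [NormedAddCommGroup E] [NormedSpace ℝ E]
    {W U : E → ℝ} {p : E →L[ℝ] ℝ} {x : E} (hU : HasFDerivAt U p x) (hx : U x = W x)
    (hlow : ∀ᶠ y in 𝓝 x, W x + p (y - x) ≤ W y) (hup : ∀ᶠ y in 𝓝 x, W y ≤ U y) :
    HasFDerivAt W p x := by
  rw [hasFDerivAt_iff_isLittleO] at hU ⊢
  refine Asymptotics.IsBigO.trans_isLittleO (Asymptotics.IsBigO.of_bound' ?_) hU
  filter_upwards [hlow, hup] with y h1 h2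
  rw [Real.norm_of_nonneg (by linarith), Real.norm_of_nonneg (by linarith)]
  linarith

/-! ### The worst case distribution -/

section WorstCase

variable {Ω : Type*} [MeasurableSpace Ω] {P : Measure Ω}

lemma integrable_withDensity_ofReal_iff {d : Ω → ℝ} (hd : Measurable d) (hd0 : ∀ ω, 0 ≤ d ω)
    {X : Ω → ℝ} : Integrable X (P.withDensity fun ω => ENNReal.ofReal (d ω)) ↔
      Integrable (fun ω => d ω * X ω) P := by
  rw [integrable_withDensity_iff_integrable_smul' hd.ennreal_ofReal
    (Eventually.of_forall fun ω => ENNReal.ofReal_lt_top)]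
  simp only [ENNReal.toReal_ofReal (hd0 _), smul_eq_mul]

lemma integral_withDensity_ofReal {d : Ω → ℝ} (hd : Measurable d) (hd0 : ∀ ω, 0 ≤ d ω)
    (X : Ω → ℝ) : ∫ ω, X ω ∂(P.withDensity fun ω => ENNReal.ofReal (d ω)) =
      ∫ ω, d ω * X ω ∂P := by
  rw [integral_withDensity_eq_integral_toReal_smul hd.ennreal_ofReal
    (Eventually.of_forall fun ω => ENNReal.ofReal_lt_top)]
  simp only [ENNReal.toReal_ofReal (hd0 _), smul_eq_mul]

lemma isProbabilityMeasure_withDensity_ofReal {d : Ω → ℝ} (hd0 : ∀ ω, 0 ≤ d ω)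
    (hdi : Integrable d P) (hd1 : ∫ ω, d ω ∂P = 1) :
    IsProbabilityMeasure (P.withDensity fun ω => ENNReal.ofReal (d ω)) := by
  refine ⟨?_⟩
  rw [withDensity_apply _ MeasurableSet.univ, Measure.restrict_univ, ← ofReal_integral_eq_lintegral_ofReal hdi (Eventually.of_forall hd0), hd1,
    ENNReal.ofReal_one]

/-- The density is ψ'(Z), so equality in Fenchel–Young evaluates the integrand φ(ψ'(Z)) as Z ψ'(Z) -
ψ(Z). -/
lemma phiDivergence_withDensity_deriv [SigmaFinite P] {φ : ℝ → ℝ≥0∞} (h1 : φ 1 = 0)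
    (hdom : conjDom φ = Set.univ) (hlsc : LowerSemicontinuous φ)
    (hdiff : Differentiable ℝ (conjReal φ)) (hd0 : ∀ s, 0 ≤ deriv (conjReal φ) s)
    {Z : Ω → ℝ} (hZ : Measurable Z) (hψ : Integrable (fun ω => conjReal φ (Z ω)) P)
    (hZd : Integrable (fun ω => Z ω * deriv (conjReal φ) (Z ω)) P) :
    phiDivergence φ (P.withDensity fun ω => ENNReal.ofReal (deriv (conjReal φ) (Z ω))) P =
      ENNReal.ofReal (∫ ω, Z ω * deriv (conjReal φ) (Z ω) ∂P - ∫ ω, conjReal φ (Z ω) ∂P) := by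
  have hφ (s : ℝ) : φ (deriv (conjReal φ) s) =
      ENNReal.ofReal (s * deriv (conjReal φ) s - conjReal φ s) := by
    obtain ⟨htop, h⟩ := apply_deriv_conjReal h1 hdom hlsc hdiff s
    rw [← h, ENNReal.ofReal_toReal htop]
  have hnn (s : ℝ) : 0 ≤ s * deriv (conjReal φ) s - conjReal φ s := by
    rw [← (apply_deriv_conjReal h1 hdom hlsc hdiff s).2]
    exact ENNReal.toReal_nonneg
  rw [phiDivergence, if_pos (withDensity_absolutelyContinuous _ _), ← integral_sub hZd hψ]
  refine Eq.trans ?_ (ofReal_integral_eq_lintegral_ofReal (hZd.sub hψ)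
    (Eventually.of_forall fun ω => hnn (Z ω))).symm
  refine lintegral_congr_ae ?_
  filter_upwards [Measure.rnDeriv_withDensity P
    (((measurable_deriv (conjReal φ)).comp hZ).ennreal_ofReal)] with ω hω
  simp only [Function.comp_apply] at hω
  rw [hω, ENNReal.toReal_ofReal (hd0 _), hφ]
  rfl

end WorstCase

/-- The dual objective at fixed multipliers is differentiable in the systematic utilities. -/
lemma hasFDerivAt_integral_conj {F : Measure (Vec J)} [IsProbabilityMeasure F]
    (hF : F ≪ volume) {ψ : ℝ → ℝ} (hconv : ConvexOn ℝ univ ψ)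
    (hdiff : Differentiable ℝ ψ) {u : Vec J} {lam mu δ : ℝ} (hδ : 0 < δ)
    (hint : ∀ m, |m - mu| ≤ δ → Integrable (fun ε => ψ ((maxUtility u ε - m) / lam)) F) :
    (∀ᶠ v in 𝓝 u, Integrable (fun ε => ψ ((maxUtility v ε - mu) / lam)) F) ∧
      Integrable (fun ε => (deriv ψ ((maxUtility u ε - mu) / lam) * lam⁻¹) •
        maxUtilityFDeriv u ε) F ∧
      HasFDerivAt (fun v => ∫ ε, ψ ((maxUtility v ε - mu) / lam) ∂F)
        (∫ ε, (deriv ψ ((maxUtility u ε - mu) / lam) * lam⁻¹) • maxUtilityFDeriv u ε ∂F) u := by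
  -- Moving u to v changes H by at most ‖v - u‖ pointwise, which has the effect of an ε-dependent
  -- shift of μ. Convexity in that shift converts integrability for μ near its optimum into a
  -- Lipschitz bound in v.
  set k : Vec J → ℝ → ℝ := fun ε t => ψ ((maxUtility u ε - (mu - t)) / lam) with hk
  have hki (t : ℝ) (ht : |t| ≤ δ) : Integrable (fun ε => k ε t) F :=
    hint (mu - t) (by simpa using ht)
  have hi0 : Integrable (fun ε => k ε 0) F := hki 0 (by simpa using hδ.le)
  have hip : Integrable (fun ε => k ε δ) F := hki δ (abs_of_pos hδ).le
  have him : Integrable (fun ε => k ε (-δ)) F := hki (-δ) (by rw [abs_neg, abs_of_pos hδ])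
  set b : Vec J → ℝ := fun ε => (|k ε δ - k ε 0| + |k ε (-δ) - k ε 0|) / δ with hb
  have hbi : Integrable b F := (((hip.sub hi0).abs).add ((him.sub hi0).abs)).div_const δ
  have hkc (ε : Vec J) : ConvexOn ℝ (Icc (-δ) δ) (k ε) := by
    refine ⟨convex_Icc _ _, fun x _ y _ s t hs ht hst => ?_⟩
    have h := hconv.2 (mem_univ ((maxUtility u ε - (mu - x)) / lam))
      (mem_univ ((maxUtility u ε - (mu - y)) / lam)) hs ht hst
    convert h using 2
    simp only [smul_eq_mul]
    linear_combination (mu - maxUtility u ε) / lam * hst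
  have hLip : ∀ v ∈ Metric.closedBall u δ, ∀ ε,
      |ψ ((maxUtility v ε - mu) / lam) - ψ ((maxUtility u ε - mu) / lam)| ≤ b ε * ‖v - u‖ := by
    intro v hv ε
    have hle := abs_maxUtility_sub_le u v ε
    have hv' : ‖v - u‖ ≤ δ := by simpa [dist_eq_norm] using hv
    have h := abs_sub_le_of_convexOn hδ (hkc ε) (hle.trans hv')
    have e1 : k ε (maxUtility v ε - maxUtility u ε) = ψ ((maxUtility v ε - mu) / lam) := by
      simp only [hk]; congr 2; ring
    have e0 : k ε 0 = ψ ((maxUtility u ε - mu) / lam) := by simp [hk]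
    rw [e1, e0] at h
    refine h.trans ?_
    rw [← e0]
    exact mul_le_mul_of_nonneg_left hle (by positivity)
  have hmeas (v : Vec J) : AEStronglyMeasurable (fun ε => ψ ((maxUtility v ε - mu) / lam)) F :=
    (hdiff.continuous.comp
      (((continuous_maxUtility v).sub continuous_const).div_const lam)).aestronglyMeasurable
  have hiu : Integrable (fun ε => ψ ((maxUtility u ε - mu) / lam)) F :=
    hint mu (by simpa using hδ.le)
  have hball : Metric.closedBall u δ ∈ 𝓝 u := Metric.closedBall_mem_nhds u hδ
  constructor
  · filter_upwards [hball] with v hv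
    refine (hiu.abs.add (hbi.mul_const ‖v - u‖)).mono' (hmeas v)
      (Eventually.of_forall fun ε => ?_)
    have h := hLip v hv ε
    have h' := abs_sub_abs_le_abs_sub (ψ ((maxUtility v ε - mu) / lam))
      (ψ ((maxUtility u ε - mu) / lam))
    simp only [Pi.add_apply, Real.norm_eq_abs]
    linarith
  · refine hasFDerivAt_integral_of_dominated_loc_of_lip' (𝕜 := ℝ) hball (fun v _ => hmeas v) hiu
      ?_ (Eventually.of_forall fun ε v hv => hLip v hv ε) hbi ?_
    · have hm : Measurable fun ε => deriv ψ ((maxUtility u ε - mu) / lam) * lam⁻¹ :=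
        ((measurable_deriv ψ).comp
          (((continuous_maxUtility u).measurable.sub_const mu).div_const lam)).mul_const _
      exact hm.aestronglyMeasurable.smul
        (stronglyMeasurable_maxUtilityFDeriv u).aestronglyMeasurable
    · filter_upwards [ae_forall_ne hF u] with ε hε
      have hH := ((hasFDerivAt_maxUtility hε).sub_const mu).mul_const lam⁻¹
      have hd : HasDerivAt ψ (deriv ψ ((maxUtility u ε - mu) / lam))
          ((maxUtility u ε - mu) * lam⁻¹) := by
        rw [← div_eq_mul_inv]; exact (hdiff _).hasDerivAt
      have := hd.comp_hasFDerivAt u hH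
      rw [smul_smul] at this
      simpa only [div_eq_mul_inv, Function.comp_def] using this

lemma exists_pos_forall_mem_dualDomain {φ : ℝ → ℝ≥0∞} {F : Measure (Vec J)} {ρ : ℝ} {u : Vec J}
    {lam mu : ℝ} (hlam : 0 < lam) (hint : (lam, mu) ∈ interior (dualDomain φ F ρ u)) :
    ∃ δ, 0 < δ ∧ δ < lam ∧ ∀ l m : ℝ, |l - lam| ≤ δ → |m - mu| ≤ δ →
      0 < l ∧ dualObjective φ F ρ u l m < ⊤ := by
  obtain ⟨r, hr, hball⟩ := Metric.mem_nhds_iff.1 (mem_interior_iff_mem_nhds.1 hint)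
  refine ⟨min (r / 2) (lam / 2), by positivity,
    (min_le_right _ _).trans_lt (half_lt_self hlam), fun l m hl hm => ?_⟩
  have hlt : min (r / 2) (lam / 2) < r := (min_le_left _ _).trans_lt (half_lt_self hr)
  have hmem : (l, m) ∈ dualDomain φ F ρ u := hball (by
    rw [Metric.mem_ball, Prod.dist_eq, max_lt_iff]
    exact ⟨hl.trans_lt hlt, hm.trans_lt hlt⟩)
  exact hmem

end DRORUM

end

/-! ### Strong duality, uniqueness of the multipliers and the gradient -/

open DRORUM in
theorem mainTheorem1 (J : ℕ) (F : Measure (DRORUM.Vec J)) (hF : DRORUM.IsNominal F)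
    (φ : ℝ → ℝ≥0∞) (hφ : DRORUM.IsDivergenceFunction φ) (hφ' : DRORUM.ConjRegular φ)
    (ρ : ℝ) (hρ : 0 ≤ ρ) (u : DRORUM.Vec J) (lam mu : ℝ)
    (hopt : DRORUM.IsDualOptimal φ F ρ u lam mu)
    (hint : (lam, mu) ∈ interior (DRORUM.dualDomain φ F ρ u)) :
    -- the optimal multipliers are unique and induce a distribution in the uncertainty set
    (∀ lam' mu' : ℝ, DRORUM.IsDualOptimal φ F ρ u lam' mu' → lam' = lam ∧ mu' = mu) ∧
    DRORUM.robustDistribution φ F u lam mu ∈ DRORUM.uncertaintySet φ F ρ ∧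
    -- (i)
    (Integrable (DRORUM.maxUtility u) (DRORUM.robustDistribution φ F u lam mu) ∧
      DRORUM.robustSurplus φ F ρ u =
        ((∫ ε, DRORUM.maxUtility u ε ∂(DRORUM.robustDistribution φ F u lam mu) : ℝ) : EReal)) ∧
    -- (ii)
    ((∀ᶠ v in 𝓝 u, DRORUM.robustSurplus φ F ρ v ≠ ⊤ ∧ DRORUM.robustSurplus φ F ρ v ≠ ⊥) ∧
      HasGradientAt (fun v => (DRORUM.robustSurplus φ F ρ v).toReal)
        (DRORUM.choiceProb (DRORUM.robustDistribution φ F u lam mu) u) u) := by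
  have hP := hF.isProbability
  have hOpen := hF.fullSupport
  have hac := hF.absolutelyContinuous
  have h1 := hφ.map_one
  have hlsc := hφ.closed
  have hlam := hopt.1
  obtain ⟨δ, hδ, hδlam, hδdom⟩ := exists_pos_forall_mem_dualDomain hlam hint
  have hfin0 := (hδdom lam mu (by simpa using hδ.le) (by simpa using hδ.le)).2
  have hdom : conjDom φ = Set.univ :=
    conjDom_eq_univ hF h1 hlam (extExpectation_conj_lt_top hlam hfin0)
  have hsconv : StrictConvexOn ℝ univ (conjReal φ) := hdom ▸ hφ'.strictConvex
  have hdiff : Differentiable ℝ (conjReal φ) := fun s => hφ'.differentiable s (by simp [hdom])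
  have hd0 (s : ℝ) : 0 ≤ deriv (conjReal φ) s := hφ'.deriv_nonneg s (by simp [hdom])
  have hψint : ∀ l m : ℝ, |l - lam| ≤ δ → |m - mu| ≤ δ →
      Integrable (fun ε => conjReal φ ((maxUtility u ε - m) / l)) F := fun l m hl hm =>
    integrable_conjReal_of_lt_top hF h1 hdom hdiff.continuous (hδdom l m hl hm).1
      (hδdom l m hl hm).2
  set Z : Vec J → ℝ := fun ε => (maxUtility u ε - mu) / lam with hZ
  have hZc : Continuous Z := ((continuous_maxUtility u).sub continuous_const).div_const lam
  have hHZ (ε : Vec J) : maxUtility u ε = mu + lam * Z ε := by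
    simp only [hZ]; field_simp; ring
  set d : Vec J → ℝ := fun ε => deriv (conjReal φ) (Z ε) with hd
  have hdm : Measurable d := (measurable_deriv _).comp hZc.measurable
  have hψ0 : Integrable (fun ε => conjReal φ (Z ε)) F :=
    hψint lam mu (by simpa using hδ.le) (by simpa using hδ.le)
  obtain ⟨⟨hdi, hd1⟩, hZdi, hZd⟩ := dual_first_order (ρ := ρ) hsconv.convexOn hdiff
    (continuous_maxUtility u).measurable hδ hδlam hψint (fun l m hl hm => by
      have := hopt.2 l m (hδdom l m hl hm).1
      rwa [dualObjective_eq_coe h1 hdom hψ0, dualObjective_eq_coe h1 hdom (hψint l m hl hm),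
        EReal.coe_le_coe_iff] at this)
  change Integrable d F at hdi
  change ∫ ε, d ε ∂F = 1 at hd1
  change Integrable (fun ε => Z ε * d ε) F at hZdi
  change ∫ ε, Z ε * d ε ∂F = ρ + ∫ ε, conjReal φ (Z ε) ∂F at hZd
  have hG : robustDistribution φ F u lam mu = F.withDensity fun ε => ENNReal.ofReal (d ε) :=
    robustDistribution_eq hac u lam mu
  set G := robustDistribution φ F u lam mu with hGdef
  have hGP : IsProbabilityMeasure G :=
    hG ▸ isProbabilityMeasure_withDensity_ofReal (fun ε => hd0 _) hdi hd1
  have hGF : G ≪ F := hG ▸ withDensity_absolutelyContinuous _ _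
  have hGi (X : Vec J → ℝ) : Integrable X G ↔ Integrable (fun ε => d ε * X ε) F := by
    rw [hG]; exact integrable_withDensity_ofReal_iff hdm fun ε => hd0 _
  have hGe (X : Vec J → ℝ) : ∫ ε, X ε ∂G = ∫ ε, d ε * X ε ∂F := by
    rw [hG]; exact integral_withDensity_ofReal hdm (fun ε => hd0 _) X
  have hdiv : phiDivergence φ G F = ENNReal.ofReal ρ := by
    rw [hG]
    refine (phiDivergence_withDensity_deriv h1 hdom hlsc hdiff hd0 hZc.measurable hψ0
      hZdi).trans ?_
    congr 1
    exact sub_eq_of_eq_add hZd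
  have hGmem : G ∈ uncertaintySet φ F ρ := ⟨hGP, hGF, hdiv.le⟩
  have hZG : Integrable Z G := (hGi Z).2 (by simpa only [mul_comm] using hZdi)
  have hZGe : ∫ ε, Z ε ∂G = ρ + ∫ ε, conjReal φ (Z ε) ∂F := by
    rw [hGe, ← hZd]; simp only [mul_comm]
  have hHG : Integrable (maxUtility u) G :=
    (((integrable_const mu).add (hZG.const_mul lam))).congr
      (Eventually.of_forall fun ε => (hHZ ε).symm)
  have hHGe : ∫ ε, maxUtility u ε ∂G = lam * ρ + mu + lam * ∫ ε, conjReal φ (Z ε) ∂F := by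
    simp only [hHZ]
    rw [integral_add (integrable_const mu) (hZG.const_mul lam), integral_const_mul, hZGe]
    simp
    ring
  have hHGv (v : Vec J) : Integrable (maxUtility v) G := by
    refine (hHG.abs.add (integrable_const ‖v - u‖)).mono'
      (continuous_maxUtility v).aestronglyMeasurable (Eventually.of_forall fun ε => ?_)
    have h := abs_maxUtility_sub_le u v ε
    have h' := abs_sub_abs_le_abs_sub (maxUtility v ε) (maxUtility u ε)
    simp only [Pi.add_apply, Real.norm_eq_abs]
    linarith
  have hlow (v : Vec J) : ((∫ ε, maxUtility v ε ∂G : ℝ) : EReal) ≤ robustSurplus φ F ρ v := by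
    rw [← extExpectation_coe (hHGv v)]
    exact le_iSup₂ (f := fun (G : Measure (Vec J)) (_ : G ∈ uncertaintySet φ F ρ) =>
      extExpectation G (fun ε => (maxUtility v ε : EReal))) G hGmem
  have hup (v : Vec J)
      (hv : Integrable (fun ε => conjReal φ ((maxUtility v ε - mu) / lam)) F) :
      robustSurplus φ F ρ v ≤
        ((lam * ρ + mu + lam * ∫ ε, conjReal φ ((maxUtility v ε - mu) / lam) ∂F : ℝ) : EReal) :=
    iSup₂_le fun G' hG' => by
      have := hG'.1
      exact extExpectation_le_dual h1 hdom hlsc hρ hG'.2.1 hG'.2.2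
        (continuous_maxUtility v).measurable hlam hv
  have hW : robustSurplus φ F ρ u = ((∫ ε, maxUtility u ε ∂G : ℝ) : EReal) :=
    le_antisymm (by rw [hHGe]; exact hup u hψ0) (hlow u)
  obtain ⟨hev, hUi, hU⟩ := hasFDerivAt_integral_conj hac hsconv.convexOn hdiff hδ
    (fun m hm => hψint lam m (by simpa using hδ.le) hm)
  have hfinite : ∀ᶠ v in 𝓝 u, robustSurplus φ F ρ v ≠ ⊤ ∧ robustSurplus φ F ρ v ≠ ⊥ := by
    filter_upwards [hev] with v hv
    exact ⟨((hup v hv).trans_lt (EReal.coe_lt_top _)).ne,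
      ((EReal.bot_lt_coe _).trans_le (hlow v)).ne'⟩
  refine ⟨?_, hGmem, ⟨hHG, hW⟩, hfinite, ?_⟩
  · intro lam' mu' hopt'
    have hlam' := hopt'.1
    have hle := hopt'.2 lam mu hlam
    have hψ' : Integrable (fun ε => conjReal φ ((maxUtility u ε - mu') / lam')) F :=
      integrable_conjReal_of_lt_top hF h1 hdom hdiff.continuous hlam' (hle.trans_lt hfin0)
    rw [dualObjective_eq_coe h1 hdom hψ0, dualObjective_eq_coe h1 hdom hψ',
      EReal.coe_le_coe_iff] at hle
    set Z' : Vec J → ℝ := fun ε => (maxUtility u ε - mu') / lam' with hZ'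
    have hZc' : Continuous Z' :=
      ((continuous_maxUtility u).sub continuous_const).div_const lam'
    have hHZ' (ε : Vec J) : maxUtility u ε = mu' + lam' * Z' ε := by
      simp only [hZ']; field_simp; ring
    change Integrable (fun ε => conjReal φ (Z' ε)) F at hψ'
    have hZG' : Integrable Z' G := (hHG.sub (integrable_const mu')).div_const lam'
    have hHGe' : ∫ ε, maxUtility u ε ∂G = mu' + lam' * ∫ ε, Z' ε ∂G := by
      rw [integral_congr_ae (Eventually.of_forall hHZ'),
        integral_add (integrable_const mu') (hZG'.const_mul lam'), integral_const_mul]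
      simp
    -- the gap in the Fenchel–Young inequality
    set q : Vec J → ℝ := fun ε =>
      conjReal φ (Z' ε) - (conjReal φ (Z ε) + (d ε * Z' ε - Z ε * d ε)) with hq
    have hq0 (ε : Vec J) : 0 ≤ q ε := by
      have := conjReal_ge_tangent h1 hdom hlsc hdiff (Z ε) (Z' ε)
      simp only [hq, hd]
      linarith
    have hdZ' : Integrable (fun ε => d ε * Z' ε) F := (hGi Z').1 hZG'
    have hqi : Integrable q F := hψ'.sub (hψ0.add (hdZ'.sub hZdi))
    have hqe : ∫ ε, q ε ∂F = ∫ ε, conjReal φ (Z' ε) ∂F + ρ - ∫ ε, Z' ε ∂G := by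
      have e1 := integral_sub hψ' (hψ0.add (hdZ'.sub hZdi))
      have e2 := integral_add hψ0 (hdZ'.sub hZdi)
      have e3 := integral_sub hdZ' hZdi
      simp only [Pi.add_apply, Pi.sub_apply] at e1 e2 e3
      rw [hGe Z']
      simp only [hq]
      linarith
    have hqz : ∫ ε, q ε ∂F = 0 := by
      refine le_antisymm ?_ (integral_nonneg hq0)
      -- Since E_G[H] is the dual value at (λ, μ), λ' E_F[q] equals Ψ(λ', μ') - Ψ(λ, μ), which is
      -- nonpositive by optimality of (λ', μ').
      have hle' : lam' * ∫ ε, q ε ∂F ≤ 0 := by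
        rw [hqe]
        linarith
      exact nonpos_of_mul_nonpos_right hle' hlam'
    have hqae : q =ᵐ[F] 0 := (integral_eq_zero_iff_of_nonneg hq0 hqi).1 hqz
    have hZeq : Z' =ᵐ[F] Z := by
      filter_upwards [hqae] with ε hε
      refine eq_of_conjReal_eq_tangent h1 hdom hlsc hdiff hsconv ?_
      simp only [hq, hd, Pi.zero_apply] at hε
      linarith
    have hfun : Z' = Z := (hZc'.ae_eq_iff_eq F hZc).1 hZeq
    -- H takes every real value: comparing Z' and Z where H = μ gives μ' = μ, and where H = μ + 1
    -- gives λ' = λ.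
    obtain ⟨ε₀, hε₀⟩ := exists_maxUtility_eq u mu
    obtain ⟨ε₁, hε₁⟩ := exists_maxUtility_eq u (mu + 1)
    have e0 := congrFun hfun ε₀
    have e1 := congrFun hfun ε₁
    simp only [hZ, hZ', hε₀, hε₁] at e0 e1
    field_simp at e0 e1
    have hmu : mu' = mu := by nlinarith
    subst hmu
    exact ⟨by linarith, rfl⟩
  -- The factor λ of the dual objective cancels the λ⁻¹ of the chain rule, leaving the
  -- G*-expectation of the derivative of H, which is the vector of choice probabilities.
  · have hD : lam • ∫ ε, (deriv (conjReal φ) ((maxUtility u ε - mu) / lam) * lam⁻¹) •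
        maxUtilityFDeriv u ε ∂F = InnerProductSpace.toDual ℝ (Vec J) (choiceProb G u) := by
      ext w
      rw [InnerProductSpace.toDual_apply_apply, ← integral_maxUtilityFDeriv_apply, hGe,
        smul_apply, ContinuousLinearMap.integral_apply hUi, smul_eq_mul,
        ← integral_const_mul]
      refine integral_congr_ae (Eventually.of_forall fun ε => ?_)
      simp only [smul_apply, smul_eq_mul, hd, hZ]
      field_simp
    have hU' := (hU.const_mul lam).const_add (lam * ρ + mu)
    rw [hD] at hU'
    rw [hasGradientAt_iff_hasFDerivAt]
    refine hasFDerivAt_of_squeeze hU' ?_ ?_ ?_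
    · rw [hW, EReal.toReal_coe, hHGe]
    · filter_upwards [hfinite] with v hv
      rw [hW, EReal.toReal_coe, InnerProductSpace.toDual_apply_apply,
        ← integral_maxUtilityFDeriv_apply,
        ← integral_add hHG (integrable_maxUtilityFDeriv_apply G u (v - u)),
        ← EReal.coe_le_coe_iff, EReal.coe_toReal hv.1 hv.2]
      refine le_trans (EReal.coe_le_coe_iff.2 ?_) (hlow v)
      refine integral_mono_ae (hHG.add (integrable_maxUtilityFDeriv_apply G u (v - u)))
        (hHGv v) ?_
      filter_upwards [ae_forall_ne (hGF.trans hac) u] with ε hε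
        using maxUtility_add_fderiv_le hε v
    · filter_upwards [hfinite, hev] with v hv hvi
      rw [← EReal.coe_le_coe_iff, EReal.coe_toReal hv.1 hv.2]
      exact hup v hvi
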